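/- Let $(M,\rho)$ be a locally compact metric space, let $\mu$ be a positive Radon measure on $M$ (a regular Borel measure), and write $B(x,r)$ for the open ball with centre $x$ and radius $r$. Assume that for some constant $c_0>1$ $$0<\mu(B(x,2r))\le c_0\,\mu(B(x,r))<\infty\qquad (x\in M,\ r>0).$$ Let $L$ be a (possibly unbounded) self-adjoint operator on the complex Hilbert space $L^2(M,\mu)$ which is positive, that is $\langle Lf,f\rangle\ge 0$ for all $f$ in its domain, and which maps real-valued functions to real-valued functions. Let $P_t=e^{-tL}$, $t\ge 0$, be the associated semigroup (the strongly continuous semigroup with generator $-L$), and assume that for every $t>0$ the operator $P_t$ is an integral operator with (measurable) kernel $p_t(x,y)$. Assume that there are constants $C^*,c^*,\alpha>0$ such that: 1. (small-time Gaussian upper bound) for all $x,y\in M$ and $0<t\le 1$, $$|p_t(x,y)|\le \frac{C^*\exp\{-c^*\rho(x,y)^2/t\}}{\sqrt{\mu(B(x,\sqrt t))\,\mu(B(y,\sqrt t))}};$$ 2. (Hölder continuity) for all $x,y,y'\in M$ and $0<t\le 1$ with $\rho(y,y')\le\sqrt t$, $$|p_t(x,y)-p_t(x,y')|\le C^*\Big(\frac{\rho(y,y')}{\sqrt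 t}\Big)^{\alpha}\frac{\exp\{-c^*\rho(x,y)^2/t\}}{\sqrt{\mu(B(x,\sqrt t))\,\mu(B(y,\sqrt t))}};$$ 3. (Markov property) $\int_M p_t(x,y)\,d\mu(y)=1$ for all $x\in M$ and $t>0$. Then the Davies–Gaffney estimate holds with the same constant $c^*$: for all open sets $U_1,U_2\subset M$ and all $f_1,f_2\in L^2(M,\mu)$ with $\operatorname{supp} f_j\subset U_j$ ($j=1,2$), where $\operatorname{supp} f_j$ is the essential support, $$|\langle P_tf_1,f_2\rangle|\le \exp\Big\{-\frac{c^*r^2}{t}\Big\}\,\|f_1\|_2\,\|f_2\|_2\qquad\text{for all } t>0,$$ where $r:=\rho(U_1,U_2)=\inf\{\rho(x,y):x\in U_1,\ y\in U_2\}$ (if $U_1$ or $U_2$ is empty, the inner product vanishes and $r$ is irrelevant). -/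

import Mathlib

open MeasureTheory Filter Topology

noncomputable section

namespace DaviesGaffney

/-- Volume doubling with constant `c₀`:
`0 < μ(B(x,2r)) ≤ c₀ μ(B(x,r)) < ∞` for all `x` and all `r > 0`. -/
def VolumeDoubling {M : Type*} [MetricSpace M] [MeasurableSpace M]
    (μ : Measure M) (c₀ : ℝ) : Prop :=
  ∀ (x : M) (r : ℝ), 0 < r →
    0 < μ (Metric.ball x (2 * r)) ∧
    μ (Metric.ball x (2 * r)) ≤ ENNReal.ofReal c₀ * μ (Metric.ball x r) ∧
    ENNReal.ofReal c₀ * μ (Metric.ball x r) < ⊤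

/-- A (possibly unbounded) operator on a complex Hilbert space is positive:
`⟨L f, f⟩ ≥ 0` on its domain. -/
def IsPositiveOp {H : Type*} [NormedAddCommGroup H] [InnerProductSpace ℂ H]
    (L : H →ₗ.[ℂ] H) : Prop :=
  ∀ f : L.domain, 0 ≤ (inner ℂ (L f) (f : H)).re

/-- The operator `L` on the complex space `L²(M, μ)` maps real-valued functions (in its domain) to
real-valued functions. -/
def MapsRealToReal {M : Type*} [MeasurableSpace M] {μ : Measure M}
    (L : Lp ℂ 2 μ →ₗ.[ℂ] Lp ℂ 2 μ) : Prop :=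
  ∀ f : L.domain, (∀ᵐ x ∂μ, ((f : Lp ℂ 2 μ) x).im = 0) → ∀ᵐ x ∂μ, (L f x).im = 0

/-- `P t = e^{-tL}` for `t ≥ 0`: the family `(P t)_{t ≥ 0}` is the strongly continuous semigroup
whose infinitesimal generator is `-L`. The last field says that `f` lies in the domain of `L` with
`L f = g` exactly when `(f - P t f) / t → g` in norm as `t → 0+`; in particular the domain of `L`
is the whole domain of the generator. The values of `P` at negative times play no role. -/
structure IsSemigroupOf {H : Type*} [NormedAddCommGroup H] [InnerProductSpace ℂ H]
    (L : H →ₗ.[ℂ] H) (P : ℝ → H →L[ℂ] H) : Prop where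
  map_zero : P 0 = ContinuousLinearMap.id ℂ H
  map_add : ∀ s t : ℝ, 0 ≤ s → 0 ≤ t → P (s + t) = (P s).comp (P t)
  strongly_continuous : ∀ f : H, ContinuousOn (fun t : ℝ => P t f) (Set.Ici 0)
  generator : ∀ f g : H, (f, g) ∈ L.graph ↔
    Tendsto (fun t : ℝ => ((t⁻¹ : ℝ) : ℂ) • (f - P t f)) (𝓝[>] 0) (𝓝 g)

/-- The bounded operator `T` on `L²(M, μ)` is the integral operator with kernel `k`:
`(T f)(x) = ∫ k(x,y) f(y) dμ(y)` for almost every `x`, the integral converging absolutely. -/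
def HasIntegralKernel {M : Type*} [MeasurableSpace M] {μ : Measure M}
    (T : Lp ℂ 2 μ →L[ℂ] Lp ℂ 2 μ) (k : M → M → ℂ) : Prop :=
  AEStronglyMeasurable (Function.uncurry k) (μ.prod μ) ∧
  ∀ f : Lp ℂ 2 μ, ∀ᵐ x ∂μ,
    Integrable (fun y => k x y * f y) μ ∧ T f x = ∫ y, k x y * f y ∂μ

/-- The Gaussian expression
`C exp(-c ρ(x,y)² / t) / √(μ(B(x,√t)) μ(B(y,√t)))`. -/
def gaussianWeight {M : Type*} [MetricSpace M] [MeasurableSpace M]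
    (μ : Measure M) (C c t : ℝ) (x y : M) : ℝ :=
  C * Real.exp (-(c * dist x y ^ 2 / t)) /
    Real.sqrt (μ.real (Metric.ball x (Real.sqrt t)) * μ.real (Metric.ball y (Real.sqrt t)))

/-- Small-time Gaussian upper bound for the kernels `p t`, `0 < t ≤ 1`. -/
def SmallTimeGaussianBound {M : Type*} [MetricSpace M] [MeasurableSpace M]
    (μ : Measure M) (p : ℝ → M → M → ℂ) (C c : ℝ) : Prop :=
  ∀ t : ℝ, 0 < t → t ≤ 1 → ∀ x y : M, ‖p t x y‖ ≤ gaussianWeight μ C c t x y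

/-- Small-time Hölder continuity of order `α` of the kernels `p t`, `0 < t ≤ 1`, in the second
variable, with Gaussian decay. -/
def SmallTimeHolder {M : Type*} [MetricSpace M] [MeasurableSpace M]
    (μ : Measure M) (p : ℝ → M → M → ℂ) (C c α : ℝ) : Prop :=
  ∀ t : ℝ, 0 < t → t ≤ 1 → ∀ x y y' : M, dist y y' ≤ Real.sqrt t →
    ‖p t x y - p t x y'‖ ≤ (dist y y' / Real.sqrt t) ^ α * gaussianWeight μ C c t x y

/-- Markov property: `∫ p t x y dμ(y) = 1` for all `t > 0` and all `x`. -/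
def MarkovProperty {M : Type*} [MeasurableSpace M]
    (μ : Measure M) (p : ℝ → M → M → ℂ) : Prop :=
  ∀ t : ℝ, 0 < t → ∀ x : M, Integrable (p t x) μ ∧ ∫ y, p t x y ∂μ = 1

/-- The support of a function defined up to null sets: a point `x` lies outside the
support exactly when `f` vanishes almost everywhere on some neighbourhood of `x`. -/
def essSupport {M : Type*} [TopologicalSpace M] [MeasurableSpace M]
    (μ : Measure M) (f : M → ℂ) : Set M :=
  {x | ∀ V ∈ 𝓝 x, ¬ ∀ᵐ y ∂μ, y ∈ V → f y = 0}

/-- The distance `inf {ρ(x,y) : x ∈ U, y ∈ V}` of two sets. It is only meaningful for nonempty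
sets; it is `0` by convention otherwise. -/
def setDist {M : Type*} [MetricSpace M] (U V : Set M) : ℝ :=
  sInf (Set.image2 dist U V)

/-- The Davies–Gaffney estimate with constant `c` for a family of bounded operators `P t`, `t > 0`.
Here `inner ℂ f₂ (P t f₁)` is `∫ (P t f₁) conj(f₂) dμ`. -/
def DaviesGaffneyEstimate {M : Type*} [MetricSpace M] [MeasurableSpace M] {μ : Measure M}
    (P : ℝ → Lp ℂ 2 μ →L[ℂ] Lp ℂ 2 μ) (c : ℝ) : Prop :=
  ∀ (U₁ U₂ : Set M), IsOpen U₁ → IsOpen U₂ →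
    ∀ f₁ f₂ : Lp ℂ 2 μ, essSupport μ f₁ ⊆ U₁ → essSupport μ f₂ ⊆ U₂ →
      ∀ t : ℝ, 0 < t →
        ‖inner ℂ f₂ (P t f₁)‖ ≤ Real.exp (-(c * setDist U₁ U₂ ^ 2 / t)) * ‖f₁‖ * ‖f₂‖

end DaviesGaffney

end

/-!
The proof compares two facts about the function `F t = ⟨P t f₁, f₂⟩`. Spectrally, `F` extends to a
holomorphic function on the right half-plane which is bounded there by `‖f₁‖ * ‖f₂‖`. If moreover
`f₁` and `f₂` have bounded support, the Gaussian kernel bound and volume doubling give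
`‖F t‖ ≤ K * t ^ (-D) * exp (-c * r ^ 2 / t)` for `0 < t ≤ 1`, with some uncontrolled `K` and `D`.
The Phragmén–Lindelöf principle in the variable `w = 1 / t` turns this pair of bounds into
`‖F t‖ ≤ ‖f₁‖ * ‖f₂‖ * exp (-c * r ^ 2 / t)` for all `t > 0`
(`norm_le_exp_of_bounded_of_small_time`): the rate on the real axis near `w = ∞` determines the
exponential type, polynomial factors do not affect it, and the constant comes from the boundary
line alone. Truncation to large balls removes the assumption on the supports.

The holomorphic extension is obtained without a spectral theorem for unbounded operators.
Differentiating `‖P t f‖²` and telescoping `⟨P t f, g⟩ - ⟨f, P t g⟩` on the domain of the generator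
show that each `P t` is a positive self-adjoint contraction (`IsSemigroupOf.isPositive`,
`IsSemigroupOf.norm_le_one`). The continuous functional calculus of the single bounded operator
`P 1` then defines `(P 1) ^ z`, which is holomorphic in `z` (`hasDerivAt_opCPow`), has norm at most
`1`, and equals `P t` at `z = t` (`IsSemigroupOf.opCPow_apply`).
-/

open MeasureTheory Filter Topology

namespace DaviesGaffney

/-! ### The semigroup consists of positive self-adjoint contractions -/

section Semigroup

variable {H : Type*} [NormedAddCommGroup H] [InnerProductSpace ℂ H]
  {L : H →ₗ.[ℂ] H} {P : ℝ → H →L[ℂ] H}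

lemma IsSemigroupOf.add_apply (hP : IsSemigroupOf L P) {s t : ℝ} (hs : 0 ≤ s) (ht : 0 ≤ t)
    (f : H) : P (s + t) f = P s (P t f) := by
  rw [hP.map_add s t hs ht]; rfl

lemma IsSemigroupOf.apply_comm (hP : IsSemigroupOf L P) {s t : ℝ} (hs : 0 ≤ s) (ht : 0 ≤ t)
    (f : H) : P s (P t f) = P t (P s f) := by
  rw [← hP.add_apply hs ht, add_comm, hP.add_apply ht hs]

/-- The semigroup preserves the domain of `L` and commutes with `L` on it. -/
lemma IsSemigroupOf.apply_mem_graph (hP : IsSemigroupOf L P) {f g : H} (h : (f, g) ∈ L.graph)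
    {s : ℝ} (hs : 0 ≤ s) : (P s f, P s g) ∈ L.graph := by
  rw [hP.generator] at h ⊢
  refine (((P s).continuous.tendsto g).comp h).congr' ?_
  filter_upwards [self_mem_nhdsWithin] with t (ht : 0 < t)
  simp only [Function.comp_apply, map_smul, map_sub]
  rw [hP.apply_comm hs ht.le]

lemma IsSemigroupOf.hasDerivWithinAt_apply (hP : IsSemigroupOf L P) {f g : H}
    (h : (f, g) ∈ L.graph) {s : ℝ} (hs : 0 ≤ s) :
    HasDerivWithinAt (fun t => P t f) (-(P s g)) (Set.Ici s) s := by
  rw [← hasDerivWithinAt_Ioi_iff_Ici, hasDerivWithinAt_iff_tendsto_slope' (by simp)]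
  have h1 := ((hP.generator _ _).1 (hP.apply_mem_graph h hs)).neg
  have h2 : Tendsto (fun t : ℝ => t - s) (𝓝[>] s) (𝓝[>] 0) := by
    refine tendsto_nhdsWithin_of_tendsto_nhds_of_eventually_within _ ?_ ?_
    · exact ((continuous_id.sub continuous_const).tendsto' s 0 (by simp)).mono_left
        nhdsWithin_le_nhds
    · filter_upwards [self_mem_nhdsWithin] with t ht using by simpa using ht
  refine (h1.comp h2).congr' ?_
  filter_upwards [self_mem_nhdsWithin] with t (ht : s < t)
  have h3 : P (t - s) (P s f) = P t f := by
    rw [← hP.add_apply (by linarith) hs, sub_add_cancel]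
  simp only [Function.comp_apply, h3, slope, vsub_eq_sub]
  rw [Complex.coe_smul, ← smul_neg, neg_sub]

/-- The energy `‖P t f‖²` decreases, because its derivative is `-2 ⟨L P t f, P t f⟩ ≤ 0`. -/
lemma IsSemigroupOf.norm_apply_le_of_mem_graph (hP : IsSemigroupOf L P) (hL : IsPositiveOp L)
    {f g : H} (h : (f, g) ∈ L.graph) {t : ℝ} (ht : 0 ≤ t) : ‖P t f‖ ≤ ‖f‖ := by
  have hd : ∀ s ∈ Set.Ico 0 t, HasDerivWithinAt (fun s => (inner ℂ (P s f) (P s f)).re)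
      (inner ℂ (P s f) (-(P s g)) + inner ℂ (-(P s g)) (P s f)).re (Set.Ici s) s := by
    intro s hs
    have := hP.hasDerivWithinAt_apply h hs.1
    exact Complex.reCLM.hasFDerivAt.comp_hasDerivWithinAt s (this.inner ℂ this)
  have hc : ContinuousOn (fun s => (inner ℂ (P s f) (P s f)).re) (Set.Icc 0 t) := by
    have := (hP.strongly_continuous f).mono ((Set.Icc_subset_Ici_self : Set.Icc 0 t ⊆ _))
    exact Complex.continuous_re.comp_continuousOn (this.inner this)
  have key := image_le_of_deriv_right_le_deriv_boundary hc hd (B := fun _ => ‖f‖ ^ 2)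
    (B' := fun _ => 0) (by
      have h0 : P 0 f = f := by rw [hP.map_zero]; rfl
      rw [h0]; exact (inner_self_eq_norm_sq (𝕜 := ℂ) f).le) continuousOn_const
    (fun s _ => hasDerivWithinAt_const _ _ _) (by
      intro s hs
      obtain ⟨x, hx1, hx2⟩ := (L.mem_graph_iff).1 (hP.apply_mem_graph h hs.1)
      have h1 := hL x
      dsimp only at hx1 hx2
      rw [hx1, hx2] at h1
      have h2 : (inner ℂ (P s f) (P s g)).re = (inner ℂ (P s g) (P s f)).re :=
        inner_re_symm (𝕜 := ℂ) _ _
      rw [inner_neg_left, inner_neg_right, Complex.add_re, Complex.neg_re, Complex.neg_re, h2]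
      linarith) (Set.right_mem_Icc.2 ht)
  have h3 : (inner ℂ (P t f) (P t f)).re = ‖P t f‖ ^ 2 := inner_self_eq_norm_sq (𝕜 := ℂ) _
  rw [h3] at key
  exact (sq_le_sq₀ (norm_nonneg _) (norm_nonneg _)).1 key

lemma IsSemigroupOf.pow (hP : IsSemigroupOf L P) {s : ℝ} (hs : 0 ≤ s) (n : ℕ) :
    P s ^ n = P (n * s) := by
  induction n with
  | zero => simp [hP.map_zero]; rfl
  | succ n ih =>
    rw [pow_succ, ih, ContinuousLinearMap.mul_def, ← hP.map_add _ _ (by positivity) hs]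
    congr 1; push_cast; ring

/-- The change of `⟨a, b⟩` when one step is moved between the factors, in terms of the errors of
the difference quotients of `a` and `b` against `z` and `w`. -/
lemma norm_inner_diffQuot_sub_le (a b a' b' : H) {h : ℝ} (hh : 0 < h) (z w : H)
    (hzw : inner ℂ z b = inner ℂ a w) :
    ‖inner ℂ a' b - inner ℂ a b'‖ ≤
      h * (‖((h⁻¹ : ℝ) : ℂ) • (a - a') - z‖ * ‖b‖ + ‖a‖ * ‖((h⁻¹ : ℝ) : ℂ) • (b - b') - w‖) := by
  have hne : (h : ℂ) ≠ 0 := by exact_mod_cast hh.ne'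
  have e : inner ℂ a' b - inner ℂ a b' = (h : ℂ) *
      (inner ℂ a (((h⁻¹ : ℝ) : ℂ) • (b - b') - w) -
        inner ℂ (((h⁻¹ : ℝ) : ℂ) • (a - a') - z) b) := by
    simp only [inner_sub_left, inner_sub_right, inner_smul_left, inner_smul_right, hzw,
      Complex.conj_ofReal]
    push_cast
    field_simp
    ring
  rw [e, norm_mul, Complex.norm_real, Real.norm_of_nonneg hh.le]
  refine mul_le_mul_of_nonneg_left ((norm_sub_le _ _).trans ?_) hh.le
  rw [add_comm]
  exact add_le_add (norm_inner_le_norm _ _) (norm_inner_le_norm _ _)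

variable [CompleteSpace H]

lemma IsSemigroupOf.norm_apply_le (hP : IsSemigroupOf L P) (hL : IsPositiveOp L)
    (hLs : IsSelfAdjoint L) {t : ℝ} (ht : 0 ≤ t) (f : H) : ‖P t f‖ ≤ ‖f‖ := by
  have hd : DenseRange ((↑) : L.domain → H) := by
    rw [DenseRange, Subtype.range_coe]; exact hLs.dense_domain
  refine hd.induction_on f ?_ fun x =>
    hP.norm_apply_le_of_mem_graph hL (L.mem_graph x) ht
  exact isClosed_le (by fun_prop) (by fun_prop)

lemma inner_apply_eq_of_isSelfAdjoint (hLs : IsSelfAdjoint L) (x y : L.domain) :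
    inner ℂ (L x) (y : H) = inner ℂ (x : H) (L y) := by
  have h := LinearPMap.adjoint_isFormalAdjoint hLs.dense_domain
  rw [LinearPMap.isSelfAdjoint_def.1 hLs] at h
  exact h x y

/-- Moving one time step `h` from the left to the right factor of `⟨P a f, P b g⟩` costs `o(h)`,
uniformly in `a` and `b`, because `L` is symmetric and commutes with the semigroup. Moving all
`n` steps of size `t / n` and letting `n → ∞` gives the symmetry of `P t`. -/
lemma IsSemigroupOf.inner_apply_of_mem_graph (hP : IsSemigroupOf L P) (hL : IsPositiveOp L)
    (hLs : IsSelfAdjoint L) {t : ℝ} (ht : 0 < t) (f g : L.domain) :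
    inner ℂ (P t f) (g : H) = inner ℂ (f : H) (P t g) := by
  set E : ℝ → ℝ := fun h => ‖((h⁻¹ : ℝ) : ℂ) • ((f : H) - P h f) - L f‖ * ‖(g : H)‖ +
    ‖(f : H)‖ * ‖((h⁻¹ : ℝ) : ℂ) • ((g : H) - P h g) - L g‖ with hE
  have hE0 : Tendsto E (𝓝[>] 0) (𝓝 0) := by
    have h1 := ((hP.generator _ _).1 (L.mem_graph f)).sub_const (L f)
    have h2 := ((hP.generator _ _).1 (L.mem_graph g)).sub_const (L g)
    rw [sub_self] at h1 h2
    simpa [hE] using (h1.norm.mul_const ‖(g : H)‖).add (h2.norm.const_mul ‖(f : H)‖)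
  have hstep : ∀ {h a b : ℝ}, 0 < h → 0 ≤ a → 0 ≤ b →
      ‖inner ℂ (P (h + a) f) (P b g) - inner ℂ (P a f) (P (h + b) g)‖ ≤ h * E h := by
    intro h a b hh ha hb
    obtain ⟨x, hx1, hx2⟩ := L.mem_graph_iff.1 (hP.apply_mem_graph (L.mem_graph f) ha)
    obtain ⟨y, hy1, hy2⟩ := L.mem_graph_iff.1 (hP.apply_mem_graph (L.mem_graph g) hb)
    have hsym := inner_apply_eq_of_isSelfAdjoint hLs x y
    dsimp only at hx1 hx2 hy1 hy2
    rw [hx1, hx2, hy1, hy2] at hsym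
    refine (norm_inner_diffQuot_sub_le (P a f) (P b g) _ _ hh _ _ hsym).trans ?_
    rw [hP.add_apply hh.le ha, hP.add_apply hh.le hb, hP.apply_comm hh.le ha,
      hP.apply_comm hh.le hb, ← map_sub, ← map_sub, ← map_smul, ← map_smul, ← map_sub, ← map_sub]
    rw [hE]
    have c := fun (u : H) => hP.norm_apply_le hL hLs ha u
    have d := fun (u : H) => hP.norm_apply_le hL hLs hb u
    exact mul_le_mul_of_nonneg_left (add_le_add
      (mul_le_mul (c _) (d _) (norm_nonneg _) (norm_nonneg _))
      (mul_le_mul (c _) (d _) (norm_nonneg _) (norm_nonneg _))) hh.le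
  have hiter : ∀ {h : ℝ}, 0 < h → ∀ (n : ℕ) {b : ℝ}, 0 ≤ b →
      ‖inner ℂ (P (n * h) f) (P b g) - inner ℂ (f : H) (P (n * h + b) g)‖ ≤ n * (h * E h) := by
    intro h hh n
    induction n with
    | zero =>
      intro b hb
      have h0 : P 0 (f : H) = f := by rw [hP.map_zero]; rfl
      simp [h0]
    | succ n ih =>
      intro b hb
      have h1 := hstep hh (a := n * h) (by positivity) hb
      have h2 := ih (b := h + b) (by positivity)
      have e1 : ((n + 1 : ℕ) : ℝ) * h = h + n * h := by push_cast; ring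
      have e2 : ((n + 1 : ℕ) : ℝ) * h + b = n * h + (h + b) := by push_cast; ring
      rw [e2, e1]
      refine (norm_sub_le_norm_sub_add_norm_sub _ _ _).trans ((add_le_add h1 h2).trans ?_)
      push_cast
      linarith
  have hlim : Tendsto (fun n : ℕ => t * E (t / ((n : ℝ) + 1))) atTop (𝓝 0) := by
    have h1 : Tendsto (fun n : ℕ => t / ((n : ℝ) + 1)) atTop (𝓝[>] 0) := by
      refine tendsto_nhdsWithin_of_tendsto_nhds_of_eventually_within _ ?_
        (Eventually.of_forall fun n => by simpa using by positivity)
      simpa [div_eq_mul_inv] using tendsto_one_div_add_atTop_nhds_zero_nat.const_mul t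
    simpa using (hE0.comp h1).const_mul t
  have hb : ∀ n : ℕ, ‖inner ℂ (P t f) (g : H) - inner ℂ (f : H) (P t g)‖ ≤
      t * E (t / ((n : ℝ) + 1)) := by
    intro n
    have hn : ((n : ℝ) + 1) ≠ 0 := by positivity
    have := hiter (h := t / ((n : ℝ) + 1)) (by positivity) (n + 1) le_rfl
    have h0 : P 0 (g : H) = g := by rw [hP.map_zero]; rfl
    have e : ((n + 1 : ℕ) : ℝ) * (t / ((n : ℝ) + 1)) = t := by push_cast; field_simp
    rwa [add_zero, ← mul_assoc, e, h0] at this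
  exact sub_eq_zero.1 (norm_le_zero_iff.1 (ge_of_tendsto' hlim hb))

lemma IsSemigroupOf.isSelfAdjoint (hP : IsSemigroupOf L P) (hL : IsPositiveOp L)
    (hLs : IsSelfAdjoint L) {t : ℝ} (ht : 0 < t) : IsSelfAdjoint (P t) := by
  rw [ContinuousLinearMap.isSelfAdjoint_iff_isSymmetric]
  have hd : DenseRange ((↑) : L.domain → H) := by
    rw [DenseRange, Subtype.range_coe]; exact hLs.dense_domain
  intro f g
  refine hd.induction_on₂ (p := fun f g => inner ℂ (P t f) g = inner ℂ f (P t g)) ?_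
    (fun f g => hP.inner_apply_of_mem_graph hL hLs ht f g) f g
  exact isClosed_eq (by fun_prop) (by fun_prop)

lemma IsSemigroupOf.isPositive (hP : IsSemigroupOf L P) (hL : IsPositiveOp L)
    (hLs : IsSelfAdjoint L) {t : ℝ} (ht : 0 < t) : 0 ≤ P t := by
  have h := hP.isSelfAdjoint hL hLs (half_pos ht)
  have e : P t = star (P (t / 2)) * P (t / 2) := by
    rw [h.star_eq, ContinuousLinearMap.mul_def, ← hP.map_add _ _ (by positivity) (by positivity),
      add_halves]
  rw [e]
  exact star_mul_self_nonneg _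

lemma IsSemigroupOf.norm_le_one (hP : IsSemigroupOf L P) (hL : IsPositiveOp L)
    (hLs : IsSelfAdjoint L) {t : ℝ} (ht : 0 ≤ t) : ‖P t‖ ≤ 1 :=
  ContinuousLinearMap.opNorm_le_bound _ zero_le_one fun f => by
    simpa using hP.norm_apply_le hL hLs ht f

end Semigroup

/-! ### Complex powers of a positive contraction -/

/-- The segment `[0, 1]` of the complex plane, which contains the spectrum of every positive
contraction. -/
def unitSegment : Set ℂ := Complex.ofReal '' Set.Icc 0 1

lemma norm_ofReal_cpow_le_one {r : ℝ} (hr : r ∈ Set.Icc (0 : ℝ) 1) {z : ℂ}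
    (hz : 0 < z.re) : ‖(r : ℂ) ^ z‖ ≤ 1 := by
  rw [Complex.norm_cpow_eq_rpow_re_of_nonneg hr.1 hz.ne']
  exact Real.rpow_le_one hr.1 hr.2 hz.le

lemma continuousOn_cpow_unitSegment {z : ℂ} (hz : 0 < z.re) :
    ContinuousOn (fun x : ℂ => x ^ z) unitSegment := by
  rintro _ ⟨r, hr, rfl⟩
  have h := Complex.continuousAt_cpow_of_re_pos (p := ((r : ℂ), z))
    (Or.inl (by simpa using hr.1)) hz
  exact (ContinuousAt.comp (f := fun x : ℂ => (x, z)) h (by fun_prop)).continuousWithinAt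

lemma exists_ofReal_eq_exp_neg {r : ℝ} (h0 : 0 < r) (h1 : r ≤ 1) :
    ∃ u : ℝ, 0 ≤ u ∧ Complex.log r = -(u : ℂ) ∧
      ∀ z : ℂ, (r : ℂ) ^ z = Complex.exp (-(u : ℂ) * z) := by
  refine ⟨-Real.log r, neg_nonneg.2 (Real.log_nonpos h0.le h1), ?_, fun z => ?_⟩
  · rw [← Complex.ofReal_log h0.le]; push_cast; ring
  · rw [Complex.cpow_def_of_ne_zero (by exact_mod_cast h0.ne'), ← Complex.ofReal_log h0.le]
    push_cast; ring_nf

lemma continuousOn_cpow_mul_log_unitSegment {z : ℂ} (hz : 0 < z.re) :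
    ContinuousOn (fun x : ℂ => x ^ z * Complex.log x) unitSegment := by
  have hz2 : 0 < (z / 2).re := by simpa using hz
  rintro _ ⟨r, hr, rfl⟩
  rcases hr.1.eq_or_lt with rfl | h0
  · -- at `0` the product is dominated by the continuous function `x ^ (z / 2)`
    have h1 : Tendsto (fun x : ℂ => 2 / z.re * ‖x ^ (z / 2)‖) (𝓝[unitSegment] ((0 : ℝ) : ℂ))
        (𝓝 0) := by
      have := (continuousOn_cpow_unitSegment hz2 _ (Set.mem_image_of_mem _ hr)).norm.const_mul
        (2 / z.re)
      have hz0 : z / 2 ≠ 0 := fun h => by rw [h] at hz2; simp at hz2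
      simpa [ContinuousWithinAt, Complex.zero_cpow hz0] using this
    rw [ContinuousWithinAt]
    simp only [Complex.ofReal_zero, Complex.log_zero, mul_zero]
    refine squeeze_zero_norm' ?_ h1
    filter_upwards [self_mem_nhdsWithin] with x hx
    obtain ⟨s, hs, rfl⟩ := hx
    rcases hs.1.eq_or_lt with rfl | hs0
    · simp; positivity
    obtain ⟨u, hu, hlog, hpow⟩ := exists_ofReal_eq_exp_neg hs0 hs.2
    have e : (s : ℂ) ^ z = (s : ℂ) ^ (z / 2) * (s : ℂ) ^ (z / 2) := by
      rw [hpow, hpow, ← Complex.exp_add]; ring_nf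
    have h2 : ‖(s : ℂ) ^ (z / 2)‖ * u ≤ 2 / z.re := by
      rw [hpow, Complex.norm_exp]
      have e1 : (-(u : ℂ) * (z / 2)).re = -(u * z.re / 2) := by
        rw [← Complex.ofReal_neg, Complex.re_ofReal_mul]
        simp; ring
      rw [e1, Real.exp_neg, inv_mul_eq_div, div_le_div_iff₀ (Real.exp_pos _) hz]
      linarith [Real.add_one_le_exp (u * z.re / 2)]
    rw [e, hlog, norm_mul, norm_mul, norm_neg, Complex.norm_real, Real.norm_of_nonneg hu, mul_assoc,
      mul_comm]
    exact mul_le_mul_of_nonneg_right h2 (norm_nonneg _)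
  · refine (continuousOn_cpow_unitSegment hz _ (Set.mem_image_of_mem _ hr)).mul ?_
    exact (continuousAt_clog (Complex.ofReal_mem_slitPlane.2 h0)).continuousWithinAt

/-- The second order Taylor estimate for `z ↦ x ^ z` holds uniformly in `x ∈ [0, 1]`: half of the
decay of `x ^ z` as `x → 0` absorbs the logarithms. -/
lemma norm_cpow_add_sub_le {z h : ℂ} (hz : 0 < z.re) (hh : ‖h‖ ≤ z.re / 2) {x : ℂ}
    (hx : x ∈ unitSegment) :
    ‖x ^ (z + h) - x ^ z - h * (x ^ z * Complex.log x)‖ ≤ 8 / z.re ^ 2 * ‖h‖ ^ 2 := by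
  obtain ⟨r, hr, rfl⟩ := hx
  have hzh : 0 < (z + h).re := by
    rw [Complex.add_re]
    have := (abs_le.1 (Complex.abs_re_le_norm h)).1
    linarith
  rcases hr.1.eq_or_lt with rfl | h0
  · have hz0 : z ≠ 0 := fun e => by simp [e] at hz
    have hzh0 : z + h ≠ 0 := fun e => by rw [e] at hzh; simp at hzh
    simp [Complex.zero_cpow hz0, Complex.zero_cpow hzh0]
    positivity
  obtain ⟨u, hu, hlog, hpow⟩ := exists_ofReal_eq_exp_neg h0 hr.2
  have e : (r : ℂ) ^ (z + h) - (r : ℂ) ^ z - h * ((r : ℂ) ^ z * Complex.log r) =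
      Complex.exp (-(u : ℂ) * z) *
        (Complex.exp (-(u : ℂ) * h) - ∑ m ∈ Finset.range 2, (-(u : ℂ) * h) ^ m / m.factorial) := by
    rw [hpow, hpow, hlog, mul_add, Complex.exp_add]
    simp [Finset.sum_range_succ]
    ring
  have e1 : ‖Complex.exp (-(u : ℂ) * z)‖ = Real.exp (-(u * z.re)) := by
    rw [Complex.norm_exp, ← Complex.ofReal_neg, Complex.re_ofReal_mul, neg_mul]
  have e2 : ‖-(u : ℂ) * h‖ = u * ‖h‖ := by
    rw [norm_mul, norm_neg, Complex.norm_real, Real.norm_of_nonneg hu]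
  have h1 := Complex.norm_exp_sub_sum_le_norm_mul_exp (-(u : ℂ) * h) 2
  rw [e2] at h1
  rw [e, norm_mul, e1]
  have h2 : Real.exp (u * ‖h‖) ≤ Real.exp (u * z.re / 2) :=
    Real.exp_le_exp.2 (by nlinarith)
  have h3 := Real.quadratic_le_exp_of_nonneg (x := u * z.re / 2) (by positivity)
  have h4 : u ^ 2 * Real.exp (-(u * z.re / 2)) ≤ 8 / z.re ^ 2 := by
    rw [Real.exp_neg, ← div_eq_mul_inv, div_le_div_iff₀ (Real.exp_pos _) (by positivity)]
    have : 0 ≤ u * z.re := by positivity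
    nlinarith
  calc _ ≤ Real.exp (-(u * z.re)) * ((u * ‖h‖) ^ 2 * Real.exp (u * z.re / 2)) := by
        gcongr
        exact h1.trans (by gcongr)
    _ = u ^ 2 * Real.exp (-(u * z.re / 2)) * ‖h‖ ^ 2 := by
        have : Real.exp (-(u * z.re)) * Real.exp (u * z.re / 2) = Real.exp (-(u * z.re / 2)) := by
          rw [← Real.exp_add]; congr 1; ring
        rw [← this]; ring
    _ ≤ _ := by gcongr

section Operator

variable {H : Type*} [NormedAddCommGroup H] [InnerProductSpace ℂ H] [CompleteSpace H]

lemma spectrum_subset_unitSegment {T : H →L[ℂ] H} (h0 : 0 ≤ T) (h1 : ‖T‖ ≤ 1) :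
    spectrum ℂ T ⊆ unitSegment := by
  intro x hx
  have hsa : IsSelfAdjoint T := .of_nonneg h0
  have hre : x = (x.re : ℂ) := hsa.mem_spectrum_eq_re hx
  have hr : x.re ∈ spectrum ℝ T := by
    rw [hre] at hx
    exact (spectrum.algebraMap_mem_iff ℂ).1 hx
  have hn : ‖x‖ ≤ 1 := by
    have := spectrum.norm_le_norm_mul_of_mem hx
    refine this.trans (mul_le_one₀ h1 (norm_nonneg _) ContinuousLinearMap.norm_id_le)
  exact ⟨x.re, ⟨spectrum_nonneg_of_nonneg h0 hr, (Complex.re_le_norm x).trans hn⟩, hre.symm⟩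

/-- The complex power `T ^ z`, defined by the continuous functional calculus. For a positive
contraction `T` and `0 < z.re` the function `x ↦ x ^ z` is continuous on the spectrum of `T`. -/
noncomputable def opCPow (T : H →L[ℂ] H) (z : ℂ) : H →L[ℂ] H := cfc (fun x : ℂ => x ^ z) T

lemma norm_opCPow_le_one {T : H →L[ℂ] H} (h0 : 0 ≤ T) (h1 : ‖T‖ ≤ 1) {z : ℂ} (hz : 0 < z.re) :
    ‖opCPow T z‖ ≤ 1 := by
  refine norm_cfc_le zero_le_one fun x hx => ?_
  obtain ⟨r, hr, rfl⟩ := spectrum_subset_unitSegment h0 h1 hx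
  exact norm_ofReal_cpow_le_one hr hz

lemma hasDerivAt_opCPow {T : H →L[ℂ] H} (h0 : 0 ≤ T) (h1 : ‖T‖ ≤ 1) {z : ℂ} (hz : 0 < z.re) :
    HasDerivAt (opCPow T) (cfc (fun x : ℂ => x ^ z * Complex.log x) T) z := by
  have hS := spectrum_subset_unitSegment h0 h1
  rw [hasDerivAt_iff_isLittleO_nhds_zero]
  have hO : (fun h : ℂ => opCPow T (z + h) - opCPow T z -
      h • cfc (fun x : ℂ => x ^ z * Complex.log x) T) =O[𝓝 0] fun h => ‖h‖ ^ 2 := by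
    refine Asymptotics.IsBigO.of_bound (8 / z.re ^ 2) ?_
    filter_upwards [Metric.closedBall_mem_nhds (0 : ℂ) (half_pos hz)] with h hh
    rw [mem_closedBall_zero_iff] at hh
    have hzh : 0 < (z + h).re := by
      rw [Complex.add_re]
      have := (abs_le.1 (Complex.abs_re_le_norm h)).1
      linarith
    have c1 := (continuousOn_cpow_unitSegment hz).mono hS
    have c2 := (continuousOn_cpow_unitSegment hzh).mono hS
    have c3 := (continuousOn_cpow_mul_log_unitSegment hz).mono hS
    rw [opCPow, opCPow, ← cfc_const_mul h _ T c3, ← cfc_sub _ _ T c2 c1,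
      ← cfc_sub (fun x : ℂ => x ^ (z + h) - x ^ z) (fun x => h * (x ^ z * Complex.log x)) T
        (c2.sub c1) (continuousOn_const.mul c3)]
    rw [Real.norm_of_nonneg (by positivity)]
    exact norm_cfc_le (by positivity) fun x hx => norm_cpow_add_sub_le hz hh (hS hx)
  refine hO.trans_isLittleO ?_
  simpa using (Asymptotics.isLittleO_norm_pow_id (E' := ℂ) one_lt_two)

lemma opCPow_pow_natCast_div {T : H →L[ℂ] H} (h0 : 0 ≤ T) (h1 : ‖T‖ ≤ 1) {k n : ℕ} (hk : 0 < k)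
    (hn : 0 < n) : opCPow (T ^ n) (((k : ℝ) / n : ℝ) : ℂ) = T ^ k := by
  have hS := spectrum_subset_unitSegment h0 h1
  have hsa : IsSelfAdjoint T := .of_nonneg h0
  have hT : IsStarNormal T := hsa.isStarNormal
  have hpos : (0 : ℝ) < k / n := by positivity
  have hc : ContinuousOn (fun x : ℂ => x ^ (((k : ℝ) / n : ℝ) : ℂ))
      ((fun x : ℂ => x ^ n) '' spectrum ℂ T) := by
    refine (continuousOn_cpow_unitSegment (by simpa using hpos)).mono ?_
    rintro _ ⟨x, hx, rfl⟩
    obtain ⟨r, hr, rfl⟩ := hS hx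
    exact ⟨r ^ n, ⟨pow_nonneg hr.1 _, pow_le_one₀ hr.1 hr.2⟩, by push_cast; rfl⟩
  rw [opCPow, ← cfc_comp_pow _ n T hc hT, ← cfc_pow_id (R := ℂ) T k hT]
  refine cfc_congr fun x hx => ?_
  obtain ⟨r, hr, rfl⟩ := hS hx
  rw [← Complex.ofReal_pow, ← Complex.ofReal_cpow (pow_nonneg hr.1 _), ← Real.rpow_natCast,
    ← Real.rpow_mul hr.1, ← Complex.ofReal_pow, ← Real.rpow_natCast]
  congr 2
  field_simp

/-- `P t = (P 1) ^ t`: for rational `t = k / n` both sides are `P (1 / n) ^ k`, and both sides are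
continuous in `t`. -/
lemma IsSemigroupOf.opCPow_apply {L : H →ₗ.[ℂ] H} {P : ℝ → H →L[ℂ] H} (hP : IsSemigroupOf L P)
    (hL : IsPositiveOp L) (hLs : IsSelfAdjoint L) {t : ℝ} (ht : 0 < t) (f : H) :
    opCPow (P 1) (t : ℂ) f = P t f := by
  have hlim : Tendsto (fun n : ℕ => (⌈t * ((n : ℝ) + 1)⌉₊ : ℝ) / ((n : ℝ) + 1)) atTop (𝓝 t) := by
    refine (tendsto_nat_ceil_mul_div_atTop ht.le).comp (f := fun n : ℕ => (n : ℝ) + 1) ?_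
    exact tendsto_atTop_add_const_right _ _ tendsto_natCast_atTop_atTop
  have h1 : Tendsto (fun n : ℕ => opCPow (P 1)
      (((⌈t * ((n : ℝ) + 1)⌉₊ : ℝ) / ((n : ℝ) + 1) : ℝ) : ℂ) f) atTop
      (𝓝 (opCPow (P 1) (t : ℂ) f)) := by
    have hc := (hasDerivAt_opCPow (hP.isPositive hL hLs one_pos)
      (hP.norm_le_one hL hLs zero_le_one) (z := (t : ℂ)) (by simpa using ht)).continuousAt
    have := hc.tendsto.comp ((Complex.continuous_ofReal.tendsto t).comp hlim)
    exact ((ContinuousLinearMap.apply ℂ H f).continuous.tendsto _).comp this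
  have h2 : Tendsto (fun n : ℕ => P ((⌈t * ((n : ℝ) + 1)⌉₊ : ℝ) / ((n : ℝ) + 1)) f) atTop
      (𝓝 (P t f)) := by
    have hc := (hP.strongly_continuous f).continuousAt (Ici_mem_nhds ht)
    exact hc.tendsto.comp hlim
  refine tendsto_nhds_unique (h1.congr fun n => ?_) h2
  set k := ⌈t * ((n : ℝ) + 1)⌉₊
  have hk : 0 < k := Nat.ceil_pos.2 (by positivity)
  have hs : (0 : ℝ) < 1 / ((n + 1 : ℕ) : ℝ) := by positivity
  have hn : (((n + 1 : ℕ) : ℝ)) ≠ 0 := by positivity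
  have e := opCPow_pow_natCast_div (hP.isPositive hL hLs hs) (hP.norm_le_one hL hLs hs.le) hk
    n.succ_pos
  rw [hP.pow hs.le, hP.pow hs.le, Nat.succ_eq_add_one, mul_one_div_cancel hn, mul_one_div] at e
  rw [Nat.cast_add_one] at e
  rw [e]

end Operator

/-! ### A Phragmén–Lindelöf argument -/

/-- A bounded holomorphic function on the right half-plane which is `O(t ^ (-D) * exp (-b / t))`
as `t → 0+` along the real axis satisfies `‖F t‖ ≤ A * exp (-b / t)` for all `t > 0`, with its
global bound `A` as the constant: the loss `t ^ (-D)` disappears. The Phragmén–Lindelöf principle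
is applied to `w ↦ exp ((b - δ) * (w + δ)) * F (1 / (w + δ))`; the shift by `δ` keeps the boundary
line inside the domain of `F`, and lowering `b` by `δ` beats the polynomial on the real axis. -/
theorem norm_le_exp_of_bounded_of_small_time {F : ℂ → ℂ}
    (hF : DifferentiableOn ℂ F {z | 0 < z.re}) {A b K : ℝ} {D : ℕ} (hb : 0 ≤ b)
    (hA : ∀ z : ℂ, 0 < z.re → ‖F z‖ ≤ A)
    (hK : ∀ t : ℝ, 0 < t → t ≤ 1 → ‖F t‖ ≤ K * (1 / t) ^ D * Real.exp (-(b / t)))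
    {t : ℝ} (ht : 0 < t) : ‖F t‖ ≤ Real.exp (-(b / t)) * A := by
  have hA0 : 0 ≤ A := (norm_nonneg _).trans (hA 1 (by simp))
  have key : ∀ δ : ℝ, 0 < δ → δ < 1 / t →
      Real.exp ((b - δ) * (1 / t)) * ‖F t‖ ≤ Real.exp (b * δ) * A := by
    intro δ hδ hδt
    set G : ℂ → ℂ := fun w => Complex.exp (((b - δ : ℝ) : ℂ) * (w + δ)) * F (1 / (w + δ)) with hG
    have hinv : ∀ w : ℂ, 0 ≤ w.re → 0 < (1 / (w + δ)).re := by
      intro w hw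
      have h1 : 0 < (w + δ).re := by simp; linarith
      have h2 : w + δ ≠ 0 := fun h => by rw [h] at h1; simp at h1
      rw [one_div, Complex.inv_re]
      exact div_pos h1 (Complex.normSq_pos.2 h2)
    have hnorm : ∀ w : ℂ, ‖G w‖ = Real.exp ((b - δ) * (w.re + δ)) * ‖F (1 / (w + δ))‖ := by
      intro w
      rw [hG, norm_mul, Complex.norm_exp, Complex.re_ofReal_mul]
      simp
    have hGle : ∀ w : ℂ, 0 ≤ w.re → ‖G w‖ ≤ Real.exp (b * (w.re + δ)) * A := by
      intro w hw
      rw [hnorm]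
      have := hA _ (hinv w hw)
      gcongr
      linarith
    have hd : DiffContOnCl ℂ G {z | 0 < z.re} := by
      refine DifferentiableOn.diffContOnCl fun w hw => ?_
      rw [Complex.closure_setOfPred_lt_re] at hw
      have hw' : 0 ≤ w.re := hw
      have h1 : 0 < (w + δ).re := by simp; linarith
      have h2 : w + δ ≠ 0 := fun h => by rw [h] at h1; simp at h1
      have hFd : DifferentiableAt ℂ F (1 / (w + δ)) :=
        hF.differentiableAt ((isOpen_lt continuous_const Complex.continuous_re).mem_nhds
          (hinv w hw'))
      have h3 : DifferentiableAt ℂ (fun w : ℂ => 1 / (w + δ)) w := by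
        fun_prop (disch := exact h2)
      have h4 : DifferentiableAt ℂ (fun w : ℂ => Complex.exp (((b - δ : ℝ) : ℂ) * (w + δ))) w := by
        fun_prop
      exact (h4.mul (hFd.comp w h3)).differentiableWithinAt
    have hexp : ∃ c < (2 : ℝ), ∃ B, G =O[Bornology.cobounded ℂ ⊓ 𝓟 {z | 0 < z.re}]
        fun z => Real.exp (B * ‖z‖ ^ c) := by
      refine ⟨1, one_lt_two, b, Asymptotics.IsBigO.of_bound (Real.exp (b * δ) * A) ?_⟩
      refine eventually_inf_principal.2 (Eventually.of_forall fun w (hw : 0 < w.re) => ?_)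
      refine (hGle w hw.le).trans ?_
      rw [Real.rpow_one, Real.norm_of_nonneg (Real.exp_pos _).le, mul_right_comm, ← Real.exp_add]
      gcongr
      nlinarith [mul_le_mul_of_nonneg_left (Complex.re_le_norm w) hb]
    have hre : IsBoundedUnder (· ≤ ·) atTop fun x : ℝ => ‖G x‖ := by
      have h1 : Tendsto (fun x : ℝ => K * ((x + δ) ^ (D : ℝ) * Real.exp (-δ * (x + δ)))) atTop
          (𝓝 (K * 0)) :=
        ((tendsto_rpow_mul_exp_neg_mul_atTop_nhds_zero D δ hδ).comp
          (tendsto_atTop_add_const_right _ δ tendsto_id)).const_mul K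
      refine h1.isBoundedUnder_le.mono_le ?_
      filter_upwards [eventually_ge_atTop 1] with x hx
      have hxδ : 0 < x + δ := by linarith
      have h2 := hK (1 / (x + δ)) (by positivity) (by rw [div_le_one hxδ]; linarith)
      rw [hnorm]
      have e1 : ((1 / (x + δ) : ℝ) : ℂ) = 1 / ((x : ℂ) + δ) := by push_cast; rfl
      rw [e1, one_div_one_div, div_div_eq_mul_div, div_one] at h2
      calc _ ≤ Real.exp ((b - δ) * (x + δ)) * (K * (x + δ) ^ D * Real.exp (-(b * (x + δ)))) := by
            rw [Complex.ofReal_re]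
            gcongr
        _ = K * (x + δ) ^ D * (Real.exp ((b - δ) * (x + δ)) * Real.exp (-(b * (x + δ)))) := by
            ring
        _ = _ := by
            rw [← Real.exp_add, Real.rpow_natCast, mul_assoc]
            congr 3
            ring
    have him : ∀ y : ℝ, ‖G (y * Complex.I)‖ ≤ Real.exp (b * δ) * A := fun y => by
      simpa using hGle (y * Complex.I) (by simp)
    have h := PhragmenLindelof.right_half_plane_of_bounded_on_real hd hexp hre him
      (z := ((1 / t - δ : ℝ) : ℂ)) (by rw [Complex.ofReal_re]; linarith)
    rw [hnorm] at h
    have e : 1 / (((1 / t - δ : ℝ) : ℂ) + δ) = (t : ℂ) := by push_cast; simp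
    rw [e, Complex.ofReal_re, sub_add_cancel] at h
    exact h
  have hlim : Real.exp (b * (1 / t)) * ‖F t‖ ≤ A := by
    have h1 : Tendsto (fun δ : ℝ => Real.exp ((b - δ) * (1 / t)) * ‖F t‖) (𝓝[>] 0)
        (𝓝 (Real.exp (b * (1 / t)) * ‖F t‖)) :=
      (Continuous.tendsto' (by fun_prop) _ _ (by simp)).mono_left nhdsWithin_le_nhds
    have h2 : Tendsto (fun δ : ℝ => Real.exp (b * δ) * A) (𝓝[>] 0) (𝓝 A) :=
      (Continuous.tendsto' (by fun_prop) _ _ (by simp)).mono_left nhdsWithin_le_nhds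
    refine le_of_tendsto_of_tendsto h1 h2 ?_
    filter_upwards [Ioo_mem_nhdsGT (show (0 : ℝ) < 1 / t by positivity)] with δ hδ
    exact key δ hδ.1 hδ.2
  rw [Real.exp_neg, inv_mul_eq_div, le_div_iff₀ (Real.exp_pos _), mul_comm]
  simpa [div_eq_mul_inv] using hlim

/-! ### Volume of small balls -/

section Volume

variable {M : Type*} [MetricSpace M] [MeasurableSpace M] {μ : Measure M} {c₀ : ℝ}

lemma VolumeDoubling.ball_lt_top (hd : VolumeDoubling μ c₀) (hc₀ : 1 < c₀) (x : M) (r : ℝ) :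
    μ (Metric.ball x r) < ⊤ := by
  rcases le_or_gt r 0 with hr | hr
  · simp [Metric.ball_eq_empty.2 hr]
  · exact ENNReal.lt_top_of_mul_ne_top_right (hd x r hr).2.2.ne
      (ENNReal.ofReal_pos.2 (by linarith)).ne'

lemma VolumeDoubling.real_ball_pos (hd : VolumeDoubling μ c₀) (hc₀ : 1 < c₀) (x : M) {r : ℝ}
    (hr : 0 < r) : 0 < μ.real (Metric.ball x r) := by
  have h := (hd x (r / 2) (half_pos hr)).1
  rw [mul_div_cancel₀ _ two_ne_zero] at h
  exact ENNReal.toReal_pos h.ne' (hd.ball_lt_top hc₀ x r).ne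

lemma VolumeDoubling.real_ball_two_pow_mul_le (hd : VolumeDoubling μ c₀) (hc₀ : 1 < c₀) (x : M)
    {r : ℝ} (hr : 0 < r) (k : ℕ) :
    μ.real (Metric.ball x (2 ^ k * r)) ≤ c₀ ^ k * μ.real (Metric.ball x r) := by
  induction k with
  | zero => simp
  | succ k ih =>
    have h := (hd x (2 ^ k * r) (by positivity)).2
    have h1 := ENNReal.toReal_mono h.2.ne h.1
    rw [ENNReal.toReal_mul, ENNReal.toReal_ofReal (by linarith), ← mul_assoc, ← pow_succ'] at h1
    refine h1.trans ?_
    rw [pow_succ', mul_assoc]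
    exact mul_le_mul_of_nonneg_left ih (by linarith)

/-- In a doubling space the volume of balls of radius `s` centred in a fixed ball decays at most
polynomially as `s → 0`. -/
lemma VolumeDoubling.real_ball_le_pow_mul (hd : VolumeDoubling μ c₀) (hc₀ : 1 < c₀) {D : ℕ}
    (hD : c₀ ≤ 2 ^ D) {x₀ x : M} {R s : ℝ} (hR : 1 ≤ R) (hx : x ∈ Metric.ball x₀ R) (hs : 0 < s)
    (hs1 : s ≤ 1) :
    μ.real (Metric.ball x₀ R) ≤ (4 * R / s) ^ D * μ.real (Metric.ball x s) := by
  have h1 : 1 ≤ 2 * R / s := by rw [le_div_iff₀ hs]; linarith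
  obtain ⟨k, hk1, hk2⟩ := exists_nat_pow_near h1 one_lt_two
  have hsub : Metric.ball x₀ R ⊆ Metric.ball x (2 ^ (k + 1) * s) := by
    intro y hy
    rw [div_lt_iff₀ hs] at hk2
    rw [Metric.mem_ball] at *
    have := dist_triangle_right y x x₀
    linarith
  calc μ.real (Metric.ball x₀ R) ≤ μ.real (Metric.ball x (2 ^ (k + 1) * s)) :=
        measureReal_mono hsub (hd.ball_lt_top hc₀ _ _).ne
    _ ≤ c₀ ^ (k + 1) * μ.real (Metric.ball x s) := hd.real_ball_two_pow_mul_le hc₀ x hs _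
    _ ≤ (4 * R / s) ^ D * μ.real (Metric.ball x s) := by
        gcongr
        calc c₀ ^ (k + 1) ≤ (2 ^ D) ^ (k + 1) := by gcongr
          _ = (2 * 2 ^ k) ^ D := by rw [← pow_succ', ← pow_mul, ← pow_mul, mul_comm]
          _ ≤ (2 * (2 * R / s)) ^ D := by gcongr
          _ = (4 * R / s) ^ D := by congr 1; ring

lemma VolumeDoubling.gaussianWeight_le (hd : VolumeDoubling μ c₀) (hc₀ : 1 < c₀) {D : ℕ}
    (hD : c₀ ≤ 2 ^ D) {C c : ℝ} (hC : 0 < C) (hc : 0 < c) {x₀ x y : M} {R t r : ℝ} (hR : 1 ≤ R)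
    (hx : x ∈ Metric.ball x₀ R) (hy : y ∈ Metric.ball x₀ R) (ht : 0 < t) (ht1 : t ≤ 1)
    (hr : 0 ≤ r) (hxy : r ≤ dist x y) :
    gaussianWeight μ C c t x y ≤
      C * (4 * R) ^ D / μ.real (Metric.ball x₀ R) * (1 / t) ^ D * Real.exp (-(c * r ^ 2 / t)) := by
  set s := Real.sqrt t with hs
  have hs0 : 0 < s := Real.sqrt_pos.2 ht
  have hs1 : s ≤ 1 := Real.sqrt_le_one.2 ht1
  have hts : t ≤ s := by
    rw [hs]; exact Real.le_sqrt_of_sq_le (by nlinarith)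
  have hV := hd.real_ball_pos hc₀ x₀ (show 0 < R by linarith)
  set V := μ.real (Metric.ball x₀ R)
  have hA : 0 < (4 * R / s) ^ D := by positivity
  have hmx : V / (4 * R / s) ^ D ≤ μ.real (Metric.ball x s) := by
    rw [div_le_iff₀' hA]; exact hd.real_ball_le_pow_mul hc₀ hD hR hx hs0 hs1
  have hmy : V / (4 * R / s) ^ D ≤ μ.real (Metric.ball y s) := by
    rw [div_le_iff₀' hA]; exact hd.real_ball_le_pow_mul hc₀ hD hR hy hs0 hs1
  have hsq : V / (4 * R / s) ^ D ≤
      Real.sqrt (μ.real (Metric.ball x s) * μ.real (Metric.ball y s)) := by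
    refine Real.le_sqrt_of_sq_le ?_
    rw [sq]
    exact mul_le_mul hmx hmy (by positivity) measureReal_nonneg
  have hexp : Real.exp (-(c * dist x y ^ 2 / t)) ≤ Real.exp (-(c * r ^ 2 / t)) := by
    gcongr
  calc gaussianWeight μ C c t x y
      ≤ C * Real.exp (-(c * r ^ 2 / t)) / (V / (4 * R / s) ^ D) := by
        unfold gaussianWeight
        gcongr
    _ = C * (4 * R) ^ D / V * (1 / s) ^ D * Real.exp (-(c * r ^ 2 / t)) := by
        rw [div_div_eq_mul_div, div_pow, div_pow, one_pow]
        field_simp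
    _ ≤ _ := by gcongr

end Volume

/-! ### Truncation and the support of functions in `L²` -/

section FiniteMeasure

variable {M : Type*} [MeasurableSpace M] {μ : Measure M}

lemma integrable_of_ae_eq_zero {S : Set M} (hS : μ S < ⊤) (f : Lp ℂ 2 μ)
    (hf : ∀ᵐ x ∂μ, x ∉ S → f x = 0) : Integrable f μ := by
  have : IsFiniteMeasure (μ.restrict S) := ⟨by simpa using hS⟩
  have h1 : IntegrableOn f S μ := ((Lp.memLp f).restrict S).integrable one_le_two
  exact h1.integrable_of_ae_notMem_eq_zero hf

lemma norm_inner_le_of_kernel_le {T : Lp ℂ 2 μ →L[ℂ] Lp ℂ 2 μ} {k : M → M → ℂ}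
    (hT : HasIntegralKernel T k) {S₁ S₂ : Set M} (h1 : μ S₁ < ⊤) (h2 : μ S₂ < ⊤)
    {f₁ f₂ : Lp ℂ 2 μ} (hf₁ : ∀ᵐ x ∂μ, x ∉ S₁ → f₁ x = 0) (hf₂ : ∀ᵐ x ∂μ, x ∉ S₂ → f₂ x = 0)
    {B : ℝ} (hB : ∀ x ∈ S₂, ∀ y ∈ S₁, ‖k x y‖ ≤ B) :
    ‖inner ℂ f₂ (T f₁)‖ ≤ B * ((∫ y, ‖f₁ y‖ ∂μ) * ∫ x, ‖f₂ x‖ ∂μ) := by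
  have i1 := integrable_of_ae_eq_zero h1 f₁ hf₁
  have i2 := integrable_of_ae_eq_zero h2 f₂ hf₂
  rw [L2.inner_def, ← mul_assoc, ← integral_const_mul]
  refine norm_integral_le_of_norm_le (i2.norm.const_mul _) ?_
  filter_upwards [hf₂, hT.2 f₁] with x hx hTx
  by_cases hxS : x ∈ S₂
  · have h3 : ‖T f₁ x‖ ≤ B * ∫ y, ‖f₁ y‖ ∂μ := by
      rw [hTx.2, ← integral_const_mul]
      refine norm_integral_le_of_norm_le (i1.norm.const_mul _) ?_
      filter_upwards [hf₁] with y hy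
      by_cases hyS : y ∈ S₁
      · rw [norm_mul]
        exact mul_le_mul_of_nonneg_right (hB x hxS y hyS) (norm_nonneg _)
      · simp [hy hyS]
    refine (norm_inner_le_norm _ _).trans ?_
    rw [mul_comm]
    exact mul_le_mul_of_nonneg_right h3 (norm_nonneg _)
  · simp [hx hxS]

/-- The restriction `1_S f` of `f ∈ L²` to a measurable set `S`, as an element of `L²`. -/
noncomputable def restrictLp {S : Set M} (hS : MeasurableSet S) (f : Lp ℂ 2 μ) : Lp ℂ 2 μ :=
  ((Lp.memLp f).indicator hS).toLp (S.indicator f)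

lemma coeFn_restrictLp {S : Set M} (hS : MeasurableSet S) (f : Lp ℂ 2 μ) :
    restrictLp hS f =ᵐ[μ] S.indicator f := MemLp.coeFn_toLp _

end FiniteMeasure

section Support

variable {M : Type*} [MetricSpace M] [MeasurableSpace M] {μ : Measure M}

/-- A function in `L²` vanishes almost everywhere outside every measurable set containing its
essential support. Compact sets are covered by finitely many null neighbourhoods, and inner
regularity passes from compact to measurable sets. -/
lemma ae_eq_zero_of_essSupport_subset [BorelSpace M] [μ.Regular]
    (hball : ∀ (x : M) (r : ℝ), μ (Metric.ball x r) < ⊤) {f : M → ℂ} (hf : Measurable f)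
    {U : Set M} (hU : MeasurableSet U) (h : essSupport μ f ⊆ U) :
    ∀ᵐ x ∂μ, x ∉ U → f x = 0 := by
  rcases isEmpty_or_nonempty M with hM | ⟨⟨x₀⟩⟩
  · exact ae_of_all _ fun x => (hM.false x).elim
  set N : Set M := {x | f x ≠ 0} \ U with hN
  have hNm : MeasurableSet N := (measurableSet_eq_fun hf measurable_const).compl.diff hU
  have hcomp : ∀ K ⊆ N, IsCompact K → μ K = 0 := by
    intro K hK hKc
    refine hKc.measure_zero_of_nhdsWithin fun x hx => ?_
    have hx' : x ∉ essSupport μ f := fun hx' => (hK hx).2 (h hx')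
    simp only [essSupport, Set.mem_ofPred_eq, not_forall, not_not] at hx'
    obtain ⟨V, hV, hV0⟩ := hx'
    refine ⟨V ∩ K, inter_mem (mem_nhdsWithin_of_mem_nhds hV) self_mem_nhdsWithin, ?_⟩
    refine measure_mono_null (fun y hy => ?_) (ae_iff.1 hV0)
    exact fun h => (hK hy.2).1 (h hy.1)
  have hzero : ∀ n : ℕ, μ (N ∩ Metric.ball x₀ n) = 0 := by
    intro n
    by_contra hne
    obtain ⟨K, hK, hKc, hlt⟩ := (hNm.inter measurableSet_ball).exists_lt_isCompact_of_ne_top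
      (measure_lt_top_of_subset Set.inter_subset_right (hball x₀ n).ne).ne (pos_iff_ne_zero.2 hne)
    exact hlt.ne' (hcomp K (hK.trans Set.inter_subset_left) hKc)
  have hN0 : μ N = 0 := by
    refine measure_mono_null (fun x hx => ?_) (measure_iUnion_null hzero)
    obtain ⟨n, hn⟩ := exists_nat_gt (dist x x₀)
    exact Set.mem_iUnion.2 ⟨n, hx, hn⟩
  refine ae_iff.2 (measure_mono_null (fun x hx => ?_) hN0)
  simp only [Set.mem_ofPred_eq, Classical.not_imp] at hx
  exact ⟨hx.2, hx.1⟩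

lemma tendsto_restrictLp_ball [OpensMeasurableSpace M] (x₀ : M) (f : Lp ℂ 2 μ) :
    Tendsto (fun n : ℕ => restrictLp (measurableSet_ball (x := x₀) (ε := (n : ℝ) + 1)) f) atTop
      (𝓝 f) := by
  rw [Lp.tendsto_Lp_iff_tendsto_eLpNorm']
  have h2 : ∫⁻ x, ‖f x‖ₑ ^ (2 : ℝ) ∂μ ≠ ⊤ := by
    have := (lintegral_rpow_enorm_lt_top_of_eLpNorm_lt_top two_ne_zero ENNReal.ofNat_ne_top
      (Lp.eLpNorm_lt_top f)).ne
    simpa using this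
  have hl : Tendsto (fun n : ℕ => ∫⁻ x, ‖(Metric.ball x₀ ((n : ℝ) + 1)).indicator f x - f x‖ₑ ^
      (2 : ℝ) ∂μ) atTop (𝓝 (∫⁻ _, 0 ∂μ)) := by
    have hfm : Measurable f := (Lp.stronglyMeasurable f).measurable
    refine tendsto_lintegral_of_dominated_convergence _ (fun n => ?_) (fun n => ?_) h2 ?_
    · exact (((hfm.indicator measurableSet_ball).sub hfm).enorm).pow_const _
    · refine ae_of_all _ fun x => ?_
      by_cases hx : x ∈ Metric.ball x₀ ((n : ℝ) + 1)
      · simp [Set.indicator_of_mem hx]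
      · simp [Set.indicator_of_notMem hx]
    · refine ae_of_all _ fun x => tendsto_const_nhds.congr' ?_
      filter_upwards [eventually_ge_atTop ⌈dist x x₀⌉₊] with n hn
      have hx : x ∈ Metric.ball x₀ ((n : ℝ) + 1) := by
        rw [Metric.mem_ball]
        have := Nat.ceil_le.1 hn
        linarith
      simp [Set.indicator_of_mem hx]
  have he : ∀ n : ℕ, eLpNorm (⇑(restrictLp (measurableSet_ball (x := x₀) (ε := (n : ℝ) + 1)) f) -
      ⇑f) 2 μ = (∫⁻ x, ‖(Metric.ball x₀ ((n : ℝ) + 1)).indicator f x - f x‖ₑ ^ (2 : ℝ) ∂μ) ^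
        (1 / 2 : ℝ) := by
    intro n
    rw [eLpNorm_congr_ae ((coeFn_restrictLp _ f).sub (ae_eq_refl _)),
      eLpNorm_eq_lintegral_rpow_enorm_toReal two_ne_zero ENNReal.ofNat_ne_top]
    simp
  simp_rw [he]
  have := hl.ennrpow_const (1 / 2 : ℝ)
  simpa using this

end Support

/-! ### The Davies–Gaffney estimate -/

/-- If `⟨P t f, g⟩` has Gaussian decay for small times, up to a constant and a polynomial loss,
then it satisfies the same Gaussian bound with constant `‖f‖ * ‖g‖` for all times. The
Phragmén–Lindelöf argument applies to its holomorphic extension `⟨(P 1) ^ z f, g⟩`. -/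
theorem IsSemigroupOf.norm_inner_le_exp {H : Type*} [NormedAddCommGroup H] [InnerProductSpace ℂ H]
    [CompleteSpace H] {L : H →ₗ.[ℂ] H} {P : ℝ → H →L[ℂ] H} (hP : IsSemigroupOf L P)
    (hL : IsPositiveOp L) (hLs : IsSelfAdjoint L) {f g : H} {b K : ℝ} {D : ℕ} (hb : 0 ≤ b)
    (hK : ∀ t : ℝ, 0 < t → t ≤ 1 →
      ‖inner ℂ g (P t f)‖ ≤ K * (1 / t) ^ D * Real.exp (-(b / t))) {t : ℝ} (ht : 0 < t) :
    ‖inner ℂ g (P t f)‖ ≤ Real.exp (-(b / t)) * ‖f‖ * ‖g‖ := by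
  have hpos := hP.isPositive hL hLs one_pos
  have hle := hP.norm_le_one hL hLs zero_le_one
  have hF : DifferentiableOn ℂ (fun z => inner ℂ g (opCPow (P 1) z f)) {z | 0 < z.re} := by
    intro z hz
    have h1 := (hasDerivAt_opCPow hpos hle hz).differentiableAt
    have h2 : DifferentiableAt ℂ (fun z => opCPow (P 1) z f) z :=
      (ContinuousLinearMap.apply ℂ H f).differentiableAt.comp z h1
    exact ((innerSL ℂ g).differentiableAt.comp z h2).differentiableWithinAt
  have hA : ∀ z : ℂ, 0 < z.re → ‖inner ℂ g (opCPow (P 1) z f)‖ ≤ ‖f‖ * ‖g‖ := by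
    intro z hz
    refine (norm_inner_le_norm _ _).trans ?_
    rw [mul_comm]
    gcongr
    simpa using (opCPow (P 1) z).le_of_opNorm_le (norm_opCPow_le_one hpos hle hz) f
  have key := norm_le_exp_of_bounded_of_small_time hF hb hA (K := K) (D := D)
    (fun s hs hs1 => by rw [hP.opCPow_apply hL hLs hs]; exact hK s hs hs1) ht
  rwa [hP.opCPow_apply hL hLs ht, ← mul_assoc] at key

lemma setDist_nonneg {M : Type*} [MetricSpace M] (U V : Set M) : 0 ≤ setDist U V :=
  Real.sInf_nonneg (by rintro _ ⟨x, _, y, _, rfl⟩; exact dist_nonneg)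

lemma setDist_le_dist {M : Type*} [MetricSpace M] {U V : Set M} {x y : M} (hx : x ∈ U)
    (hy : y ∈ V) : setDist U V ≤ dist x y :=
  csInf_le ⟨0, by rintro _ ⟨x, _, y, _, rfl⟩; exact dist_nonneg⟩ ⟨x, hx, y, hy, rfl⟩

end DaviesGaffney

open DaviesGaffney in
theorem proposition2p7 {M : Type*} [MetricSpace M] [LocallyCompactSpace M]
    [MeasurableSpace M] [BorelSpace M] (μ : Measure M) [μ.Regular]
    (c₀ : ℝ) (hc₀ : 1 < c₀) (hdoubling : DaviesGaffney.VolumeDoubling μ c₀)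
    (L : Lp ℂ 2 μ →ₗ.[ℂ] Lp ℂ 2 μ) (hL_selfAdjoint : IsSelfAdjoint L)
    (hL_positive : DaviesGaffney.IsPositiveOp L)
    (hL_real : DaviesGaffney.MapsRealToReal L)
    (P : ℝ → Lp ℂ 2 μ →L[ℂ] Lp ℂ 2 μ) (hP : DaviesGaffney.IsSemigroupOf L P)
    (p : ℝ → M → M → ℂ)
    (hp : ∀ t : ℝ, 0 < t → DaviesGaffney.HasIntegralKernel (P t) (p t))
    (C c α : ℝ) (hC : 0 < C) (hc : 0 < c) (hα : 0 < α)
    (hgauss : DaviesGaffney.SmallTimeGaussianBound μ p C c)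
    (hholder : DaviesGaffney.SmallTimeHolder μ p C c α)
    (hmarkov : DaviesGaffney.MarkovProperty μ p) :
    DaviesGaffney.DaviesGaffneyEstimate P c := by
  intro U₁ U₂ hU₁ hU₂ f₁ f₂ hf₁ hf₂ t ht
  rcases isEmpty_or_nonempty M with hM | ⟨⟨x₀⟩⟩
  · have : f₁ = 0 := Lp.ext (ae_of_all _ fun x => (hM.false x).elim)
    simp [this]
  obtain ⟨D, hD⟩ := pow_unbounded_of_one_lt c₀ one_lt_two
  have hball := hdoubling.ball_lt_top hc₀
  have hz₁ := ae_eq_zero_of_essSupport_subset hball (Lp.stronglyMeasurable f₁).measurable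
    hU₁.measurableSet hf₁
  have hz₂ := ae_eq_zero_of_essSupport_subset hball (Lp.stronglyMeasurable f₂).measurable
    hU₂.measurableSet hf₂
  set r := setDist U₁ U₂
  have hr : 0 ≤ r := setDist_nonneg _ _
  -- functions supported in a fixed ball are integrable, so the kernel bound applies to them
  have htrunc : ∀ n : ℕ,
      ‖inner ℂ (restrictLp (measurableSet_ball (x := x₀) (ε := (n : ℝ) + 1)) f₂)
        (P t (restrictLp (measurableSet_ball (x := x₀) (ε := (n : ℝ) + 1)) f₁))‖ ≤
      Real.exp (-(c * r ^ 2 / t)) *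
        ‖restrictLp (measurableSet_ball (x := x₀) (ε := (n : ℝ) + 1)) f₁‖ *
        ‖restrictLp (measurableSet_ball (x := x₀) (ε := (n : ℝ) + 1)) f₂‖ := by
    intro n
    set A := Metric.ball x₀ ((n : ℝ) + 1)
    set g₁ := restrictLp (measurableSet_ball (x := x₀) (ε := (n : ℝ) + 1)) f₁
    set g₂ := restrictLp (measurableSet_ball (x := x₀) (ε := (n : ℝ) + 1)) f₂
    have hzero : ∀ {f : Lp ℂ 2 μ} {U : Set M}, (∀ᵐ x ∂μ, x ∉ U → f x = 0) →
        ∀ᵐ x ∂μ, x ∉ U ∩ A →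
          restrictLp (measurableSet_ball (x := x₀) (ε := (n : ℝ) + 1)) f x = 0 := by
      intro f U h
      filter_upwards [h, coeFn_restrictLp measurableSet_ball f] with x hx hx' hn
      rw [hx']
      by_cases hA : x ∈ A
      · rw [Set.indicator_of_mem hA, hx fun hU => hn ⟨hU, hA⟩]
      · rw [Set.indicator_of_notMem hA]
    have hfin : ∀ U : Set M, μ (U ∩ A) < ⊤ := fun U =>
      measure_lt_top_of_subset Set.inter_subset_right (hball x₀ _).ne
    refine hP.norm_inner_le_exp hL_positive hL_selfAdjoint (f := g₁) (g := g₂) (D := D)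
      (K := C * (4 * ((n : ℝ) + 1)) ^ D / μ.real A *
        ((∫ y, ‖g₁ y‖ ∂μ) * ∫ x, ‖g₂ x‖ ∂μ)) (by positivity) (fun s hs hs1 => ?_) ht
    refine (norm_inner_le_of_kernel_le (hp s hs) (hfin U₁) (hfin U₂) (hzero hz₁) (hzero hz₂)
      fun x hx y hy => (hgauss s hs hs1 x y).trans
        (hdoubling.gaussianWeight_le hc₀ hD.le hC hc (by simp) hx.2 hy.2 hs hs1 hr
          (by rw [dist_comm]; exact setDist_le_dist hy.1 hx.1))).trans (le_of_eq ?_)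
    ring
  have h1 := tendsto_restrictLp_ball x₀ f₁
  have h2 := tendsto_restrictLp_ball x₀ f₂
  exact le_of_tendsto_of_tendsto' (h2.inner (((P t).continuous.tendsto f₁).comp h1)).norm
    ((h1.norm.const_mul _).mul h2.norm) htrunc
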